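/- Let $n\ge 0$ and $[n]=\{1,\dots,n\}$. A Bernoulli factory with $n$ input coins is a (possibly infinite) rooted binary tree in which every node has either two children (an internal node) or none (a leaf). Each internal node is labelled either with one of the input coins $i\in[n]$ or with a constant in $(0,1)$, and each leaf is labelled with $0$ or $1$. To execute it with coins of biases $p=(p_1,\dots,p_n)\in[0,1]^n$, start at the root; at each internal node make a fresh independent flip of a coin, of bias $p_i$ if the label is the input coin $i$ and of bias $c$ if the label is the constant $c$; go to the left child if the result is $0$ and to the right child if it is $1$; on reaching a leaf, stop and output its label. The tree does not depend on $p$. The factory implements $f:[0,1]^n\to[0,1]$ if for every $p\in[0,1]^n$, boundary included, the execution with coins $p$ reaches a leaf almost surely and outputs $1$ with probability $f(p)$. For a partition of $[n]$ into three (possibly empty) sets $A,S,B$, let $$F_{A,S,B}=\{p\in[0,1]^n:\ p_i=0\ (i\in A),\ 0<p_i<1\ (i\in S),\ p_i=1\ (i\in B)\}.$$ A function $f:[0,1]^n\to[0,1]$ is called polynomially bounded if there are an integer $m\ge 0$ and a real $c>0$ such that for every partition $(A,S,B)$ of $[n]$ for which $f$ is not identically $0$ on $F_{A,S,B}$, we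 have $$f(p)\ \ge\ c\Bigl(\prod_{i\in A}(1-p_i)\prod_{i\in S}p_i(1-p_i)\prod_{i\in B}p_i\Bigr)^m\qquad\text{for all } p\in[0,1]^n.$$ Theorem. A function $f:[0,1]^n\to[0,1]$ can be implemented by a Bernoulli factory if and only if $f$ is continuous and both $f$ and $1-f$ are polynomially bounded. -/

import Mathlib

noncomputable section

namespace BernoulliFactory

/-- The hypercube `[0,1]^n`. -/
abbrev Cube (n : ℕ) : Type := Fin n → unitInterval

/-- Labels of the nodes of a factory with `n` input coins. An internal node is labelled with one of
the input coins or with a constant in `(0,1)`; a leaf is labelled with an output,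
`false` for `0` and `true` for `1`. -/
inductive NodeLabel (n : ℕ) : Type
  | coin (i : Fin n) : NodeLabel n
  | const (c : unitInterval) (hc : 0 < c ∧ c < 1) : NodeLabel n
  | leaf (b : Bool) : NodeLabel n

/-- A possibly infinite rooted binary tree whose nodes have two or no children, with labels.
A node is addressed by the list of edges that lead to it from the root `[]`
(`false` is the left edge `0`, `true` is the right edge `1`); the children of an internal node `w`
are `w ++ [false]` and `w ++ [true]`. The nodes of the tree are the addresses that have no proper
prefix labelled as a leaf; labels at other addresses play no role. -/
structure Factory (n : ℕ) where
  label : List Bool → NodeLabel n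

namespace Factory

variable {n : ℕ}

/-- The bias of the coin that is flipped at the node `w`. Nothing is flipped at a leaf:
the value there is never used. -/
def bias (T : Factory n) (p : Cube n) (w : List Bool) : unitInterval :=
  match T.label w with
  | .coin i => p i
  | .const c _ => c
  | .leaf _ => 0

/-- The law `ℙ_p` of the coin flips of the factory with coins `p`: the flips at the
nodes are independent, and the one at `w` is `true` with probability `T.bias p w`. -/
def flipLaw (T : Factory n) (p : Cube n) : MeasureTheory.Measure (List Bool → Bool) :=
  MeasureTheory.Measure.infinitePi
    (fun w => ProbabilityTheory.bernoulliMeasure true false (T.bias p w))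

/-- The node where the execution with flips `ω` is after `k` steps: it starts at the root, follows
at each internal node the edge given by the flip at that node, and stays at a leaf. -/
def position (T : Factory n) (ω : List Bool → Bool) : ℕ → List Bool
  | 0 => []
  | k + 1 =>
    match T.label (T.position ω k) with
    | .leaf _ => T.position ω k
    | _ => T.position ω k ++ [ω (T.position ω k)]

/-- The execution with flips `ω` reaches a leaf labelled `b`, that is, terminates with output `b`. -/
def Outputs (T : Factory n) (ω : List Bool → Bool) (b : Bool) : Prop :=
  ∃ k : ℕ, T.label (T.position ω k) = NodeLabel.leaf b

/-- The factory is valid: for all coins `p` it reaches a leaf almost surely. -/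
def Valid (T : Factory n) : Prop :=
  ∀ p : Cube n, ∀ᵐ ω ∂(T.flipLaw p), ∃ b : Bool, T.Outputs ω b

/-- The factory implements `f`: it is valid and outputs `1` with probability `f p`, for all `p`. -/
def Implements (T : Factory n) (f : Cube n → unitInterval) : Prop :=
  T.Valid ∧ ∀ p : Cube n, (T.flipLaw p).real {ω | T.Outputs ω true} = (f p : ℝ)

end Factory

/-- The sets `A`, `S`, `B` (possibly empty) partition the set of indices. -/
def IsPartition {n : ℕ} (A S B : Finset (Fin n)) : Prop :=
  Disjoint A S ∧ Disjoint A B ∧ Disjoint S B ∧ A ∪ S ∪ B = Finset.univ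

/-- The open face `F_{A,S,B}` of the hypercube. -/
def openFace {n : ℕ} (A S B : Finset (Fin n)) : Set (Cube n) :=
  {p | (∀ i ∈ A, p i = 0) ∧ (∀ i ∈ S, 0 < p i ∧ p i < 1) ∧ (∀ i ∈ B, p i = 1)}

/-- The polynomial `(1-p)^A p^S (1-p)^S p^B` of the open face `F_{A,S,B}`. -/
def facePoly {n : ℕ} (A S B : Finset (Fin n)) (p : Cube n) : ℝ :=
  (∏ i ∈ A, (1 - (p i : ℝ))) * (∏ i ∈ S, (p i : ℝ)) * (∏ i ∈ S, (1 - (p i : ℝ))) *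
    (∏ i ∈ B, (p i : ℝ))

/-- Polynomially bounded functions on the hypercube. -/
def PolynomiallyBounded {n : ℕ} (f : Cube n → unitInterval) : Prop :=
  ∃ m : ℕ, ∃ c : ℝ, 0 < c ∧ ∀ A S B : Finset (Fin n), IsPartition A S B →
    (¬ ∀ q ∈ openFace A S B, f q = 0) →
    ∀ p : Cube n, c * facePoly A S B p ^ m ≤ (f p : ℝ)

end BernoulliFactory

end

/-!
A factory reaches a given leaf with a probability that is a product of factors `p i`, `1 - p i` and
constants. So the probability `hitProb` of a given output within `k` steps is continuous in the
biases `p` and increases with `k`. This makes both output probabilities `f` and `1 - f` lower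
semicontinuous, hence `f` continuous. If `f` is positive somewhere on a face, then some leaf can be
reached there, and the path to it uses only outcomes that are possible on the face. Each such factor
is at least `facePoly`, so the path gives the polynomial lower bound
(`Factory.exists_mul_facePoly_pow_le_hitProb`).

For the converse, it suffices to find for each admissible `f` (`f` continuous, `f` and `1 - f`
polynomially bounded) a function `g` that can be implemented and satisfies `g ≤ 4 f` and
`1 - g ≤ 4 (1 - f)`. Indeed, then `f = g / 8 + (7 / 8) f'`, where `f'` and `1 - f'` are at least
`4 / 7` times `f` and `1 - f`, so that `f'` is admissible again (`Admissible.exists_step`).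
Iteration writes `f` as the mixture of functions `g₀, g₁, …` with the geometric weights
`(1 / 8) (7 / 8) ^ j`. A factory implements it by flipping a coin of bias `1 / 8` until it shows
`1` and then executing the factory of the respective `g_j` (`Factory.computes_mixture`).

The function `g` comes from finitely many flips (`Admissible.exists_computes`). Flip each coin
`R * L` times, round the empirical frequencies to `0` or `1` if they are closer than `1 / R` to it,
and output `1` if `f` is at least `1 / 2` at the result. By symmetry between `f` and `1 - f` only
`g ≤ 4 f` is at stake, at points `p` where `f p < 1 / 4`. There an output `1` needs an atypical
result on a face on which `f` does not vanish. Because of the rounding a result on the face has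
probability at most `facePoly ^ L`, while `f p ≥ c * facePoly ^ m` with `m` fixed, which settles the
case that `facePoly` is small at `p`. If it is not small, then `f p` is bounded below, and the
law of large numbers suffices (`PolynomiallyBounded.eventually_flipExp_le`).
-/

open MeasureTheory ProbabilityTheory Filter Topology

noncomputable section

namespace BernoulliFactory

variable {n : ℕ}

/-! ### Output probabilities after finitely many steps -/

namespace Factory

/-- The probability that the execution with coins `p`, started at the node `w`, reaches a leaf
labelled `b` within `k` steps, defined by conditioning on the first flip. -/
def hitProb (T : Factory n) (p : Cube n) (b : Bool) : ℕ → List Bool → ℝ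
  | 0, w =>
    match T.label w with
    | .leaf b' => if b' = b then 1 else 0
    | _ => 0
  | k + 1, w =>
    match T.label w with
    | .leaf b' => if b' = b then 1 else 0
    | _ => T.bias p w * hitProb T p b k (w ++ [true]) +
        (1 - T.bias p w) * hitProb T p b k (w ++ [false])

variable (T : Factory n) (p : Cube n) (b : Bool)

lemma hitProb_of_leaf {w : List Bool} {b' : Bool} (h : T.label w = .leaf b') (k : ℕ) :
    T.hitProb p b k w = if b' = b then 1 else 0 := by
  cases k <;> simp [hitProb, h]

lemma hitProb_zero_of_not_leaf {w : List Bool} (h : ∀ b', T.label w ≠ .leaf b') :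
    T.hitProb p b 0 w = 0 := by
  rw [hitProb]
  split
  · next b' hb => exact absurd hb (h b')
  · rfl

lemma hitProb_succ_of_not_leaf {w : List Bool} (h : ∀ b', T.label w ≠ .leaf b') (k : ℕ) :
    T.hitProb p b (k + 1) w = T.bias p w * T.hitProb p b k (w ++ [true]) +
        (1 - T.bias p w) * T.hitProb p b k (w ++ [false]) := by
  rw [hitProb]
  split
  · next b' hb => exact absurd hb (h b')
  · rfl

lemma hitProb_nonneg (k : ℕ) (w : List Bool) : 0 ≤ T.hitProb p b k w := by
  induction k generalizing w with
  | zero =>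
    by_cases h : ∃ b', T.label w = .leaf b'
    · obtain ⟨b', hb⟩ := h
      rw [hitProb_of_leaf T p b hb]; split_ifs <;> norm_num
    · push Not at h
      rw [hitProb_zero_of_not_leaf T p b h]
  | succ k ih =>
    by_cases h : ∃ b', T.label w = .leaf b'
    · obtain ⟨b', hb⟩ := h
      rw [hitProb_of_leaf T p b hb]; split_ifs <;> norm_num
    · push Not at h
      rw [hitProb_succ_of_not_leaf T p b h]
      exact add_nonneg (mul_nonneg (T.bias p w).2.1 (ih _))
        (mul_nonneg (sub_nonneg.2 (T.bias p w).2.2) (ih _))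

lemma hitProb_le_succ (k : ℕ) (w : List Bool) : T.hitProb p b k w ≤ T.hitProb p b (k + 1) w := by
  induction k generalizing w with
  | zero =>
    by_cases h : ∃ b', T.label w = .leaf b'
    · obtain ⟨b', hb⟩ := h
      rw [hitProb_of_leaf T p b hb, hitProb_of_leaf T p b hb]
    · push Not at h
      rw [hitProb_zero_of_not_leaf T p b h]
      exact hitProb_nonneg T p b _ _
  | succ k ih =>
    by_cases h : ∃ b', T.label w = .leaf b'
    · obtain ⟨b', hb⟩ := h
      rw [hitProb_of_leaf T p b hb, hitProb_of_leaf T p b hb]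
    · push Not at h
      rw [hitProb_succ_of_not_leaf T p b h, hitProb_succ_of_not_leaf T p b h]
      exact add_le_add (mul_le_mul_of_nonneg_left (ih _) (T.bias p w).2.1)
        (mul_le_mul_of_nonneg_left (ih _) (sub_nonneg.2 (T.bias p w).2.2))

lemma hitProb_monotone (w : List Bool) : Monotone fun k => T.hitProb p b k w :=
  monotone_nat_of_le_succ fun k => hitProb_le_succ T p b k w

lemma hitProb_le_one (k : ℕ) (w : List Bool) : T.hitProb p b k w ≤ 1 := by
  induction k generalizing w with
  | zero =>
    by_cases h : ∃ b', T.label w = .leaf b'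
    · obtain ⟨b', hb⟩ := h
      rw [hitProb_of_leaf T p b hb]; split_ifs <;> norm_num
    · push Not at h
      rw [hitProb_zero_of_not_leaf T p b h]
      norm_num
  | succ k ih =>
    by_cases h : ∃ b', T.label w = .leaf b'
    · obtain ⟨b', hb⟩ := h
      rw [hitProb_of_leaf T p b hb]; split_ifs <;> norm_num
    · push Not at h
      rw [hitProb_succ_of_not_leaf T p b h]
      have h1 := mul_le_mul_of_nonneg_left (ih (w ++ [true])) (T.bias p w).2.1
      have h2 := mul_le_mul_of_nonneg_left (ih (w ++ [false])) (sub_nonneg.2 (T.bias p w).2.2)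
      linarith

lemma continuous_bias (w : List Bool) : Continuous fun p => T.bias p w := by
  unfold bias
  cases T.label w with
  | coin i => exact continuous_apply i
  | const c hc => exact continuous_const
  | leaf b' => exact continuous_const

lemma continuous_hitProb (k : ℕ) (w : List Bool) : Continuous fun p => T.hitProb p b k w := by
  induction k generalizing w with
  | zero =>
    by_cases h : ∃ b', T.label w = .leaf b'
    · obtain ⟨b', hb⟩ := h
      simp only [hitProb_of_leaf T _ b hb]; exact continuous_const
    · push Not at h
      simp only [hitProb_zero_of_not_leaf T _ b h]; exact continuous_const
  | succ k ih =>
    by_cases h : ∃ b', T.label w = .leaf b'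
    · obtain ⟨b', hb⟩ := h
      simp only [hitProb_of_leaf T _ b hb]; exact continuous_const
    · push Not at h
      simp only [hitProb_succ_of_not_leaf T _ b h]
      have hb : Continuous fun p => (T.bias p w : ℝ) :=
        continuous_subtype_val.comp (continuous_bias T w)
      exact (hb.mul (ih _)).add ((continuous_const.sub hb).mul (ih _))

/-! ### The law of the execution -/

/-- The flips that send the execution along `w`, if no leaf is met on the way: at each proper
prefix of `w` the flip is the next letter of `w`. -/
def flipsAlong (w : List Bool) : Set (List Bool → Bool) :=
  {ω | ∀ v c, v ++ [c] <+: w → ω v = c}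

lemma flipsAlong_nil : flipsAlong [] = Set.univ := by
  ext ω; simp [flipsAlong]

lemma flipsAlong_concat (w : List Bool) (c : Bool) :
    flipsAlong (w ++ [c]) = {ω | ω w = c} ∩ flipsAlong w := by
  ext ω
  simp only [flipsAlong, Set.mem_ofPred_eq, List.prefix_concat_iff, Set.mem_inter_iff]
  constructor
  · intro h
    exact ⟨h w c (Or.inl rfl), fun v d hv => h v d (Or.inr hv)⟩
  · rintro ⟨h1, h2⟩ v d (hv | hv)
    · obtain ⟨rfl, hd⟩ := List.append_inj' hv rfl
      simp only [List.cons.injEq, and_true] at hd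
      rw [h1, hd]
    · exact h2 v d hv

/-- `flipsAlong w` is a box on finitely many nodes, all of them above `w`. -/
lemma flipsAlong_eq_pi (w : List Bool) :
    ∃ (s : Finset (List Bool)) (t : List Bool → Set Bool),
      (∀ v ∈ s, v.length < w.length) ∧ flipsAlong w = Set.pi s t := by
  induction w using List.reverseRecOn with
  | nil => exact ⟨∅, fun _ => Set.univ, by simp, by simp [flipsAlong_nil]⟩
  | append_singleton w c ih =>
    obtain ⟨s, t, hs, hw⟩ := ih
    have hws : w ∉ s := fun h => lt_irrefl _ (hs w h)
    refine ⟨insert w s, Function.update t w {c}, ?_, ?_⟩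
    · intro v hv
      rcases Finset.mem_insert.1 hv with rfl | hv
      · simp
      · have := hs v hv
        simp only [List.length_append, List.length_singleton]; omega
    · rw [flipsAlong_concat, hw, Finset.coe_insert, Set.insert_pi, Function.update_self]
      congr 1
      refine Set.pi_congr rfl fun v hv => ?_
      rw [Function.update_of_ne]
      rintro rfl
      exact hws hv

instance : IsProbabilityMeasure (T.flipLaw p) := by
  unfold flipLaw; infer_instance

/-- The flip at `w` is independent of the flips above `w`. -/
lemma flipLaw_flipsAlong_concat (w : List Bool) (c : Bool) :
    (T.flipLaw p).real (flipsAlong (w ++ [c])) =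
      (if c then (T.bias p w : ℝ) else 1 - T.bias p w) * (T.flipLaw p).real (flipsAlong w) := by
  obtain ⟨s, t, hs, hw⟩ := flipsAlong_eq_pi w
  have hws : w ∉ s := fun h => lt_irrefl _ (hs w h)
  have hcongr : Set.pi (s : Set (List Bool)) t = Set.pi s (Function.update t w {c}) := by
    refine Set.pi_congr rfl fun v hv => ?_
    rw [Function.update_of_ne]
    rintro rfl
    exact hws hv
  have hw' : flipsAlong (w ++ [c]) =
      Set.pi (insert w s : Finset (List Bool)) (Function.update t w {c}) := by
    rw [flipsAlong_concat, hw, Finset.coe_insert, Set.insert_pi, Function.update_self, ← hcongr]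
    rfl
  rw [hw', hw, hcongr, measureReal_def, measureReal_def, flipLaw,
    Measure.infinitePi_pi _ (fun _ _ => MeasurableSet.of_discrete),
    Measure.infinitePi_pi _ (fun _ _ => MeasurableSet.of_discrete),
    Finset.prod_insert hws, ENNReal.toReal_mul, Function.update_self]
  congr 1
  rw [← measureReal_def]
  cases c
  · rw [bernoulliMeasure_real_apply_of_notMem_of_mem] <;> simp
  · rw [bernoulliMeasure_real_apply_of_mem_of_notMem] <;> simp

lemma position_succ_of_leaf {ω : List Bool → Bool} {k : ℕ} {b' : Bool}
    (h : T.label (T.position ω k) = .leaf b') : T.position ω (k + 1) = T.position ω k := by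
  rw [position, h]

lemma position_succ_of_not_leaf {ω : List Bool → Bool} {k : ℕ}
    (h : ∀ b', T.label (T.position ω k) ≠ .leaf b') :
    T.position ω (k + 1) = T.position ω k ++ [ω (T.position ω k)] := by
  rw [position]
  split
  · next b' hb => exact absurd hb (h b')
  · rfl

lemma position_add_of_leaf {ω : List Bool → Bool} {k : ℕ} {b' : Bool}
    (h : T.label (T.position ω k) = .leaf b') (j : ℕ) :
    T.position ω (k + j) = T.position ω k := by
  induction j with
  | zero => rfl
  | succ j ih =>
    rw [← add_assoc, position_succ_of_leaf (b' := b'), ih]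
    rw [ih, h]

lemma position_of_flipsAlong {w : List Bool}
    (hw : ∀ v c, v ++ [c] <+: w → ∀ b', T.label v ≠ .leaf b')
    {ω : List Bool → Bool} (hω : ω ∈ flipsAlong w) : T.position ω w.length = w := by
  induction w using List.reverseRecOn with
  | nil => rfl
  | append_singleton w c ih =>
    rw [flipsAlong_concat] at hω
    have h := ih (fun v d hv => hw v d (hv.trans (List.prefix_append _ _))) hω.2
    rw [List.length_append, List.length_singleton, position_succ_of_not_leaf, h, hω.1]
    rw [h]
    exact hw w c List.prefix_rfl

/-- The event that after `k` steps the execution is at a leaf labelled `b`. -/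
def hitEvent (k : ℕ) : Set (List Bool → Bool) := {ω | T.label (T.position ω k) = .leaf b}

open Classical in
lemma measurableSet_position (k : ℕ) (w : List Bool) : MeasurableSet {ω | T.position ω k = w} := by
  induction k generalizing w with
  | zero =>
    simp only [position]
    exact MeasurableSet.const _
  | succ k ih =>
    have : {ω | T.position ω (k + 1) = w} = ⋃ v, {ω | T.position ω k = v} ∩
        (fun ω : List Bool → Bool => ω v) ⁻¹'
          {c | (if ∃ b', T.label v = .leaf b' then v else v ++ [c]) = w} := by
      ext ω
      simp only [Set.mem_ofPred_eq, Set.mem_iUnion, Set.mem_inter_iff, Set.mem_preimage,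
        exists_eq_left']
      by_cases h : ∃ b', T.label (T.position ω k) = .leaf b'
      · rw [if_pos h]
        obtain ⟨b', hb⟩ := h
        rw [position_succ_of_leaf T hb]
      · rw [if_neg h]
        push Not at h
        rw [position_succ_of_not_leaf T h]
    rw [this]
    exact MeasurableSet.iUnion fun v =>
      (ih v).inter (measurable_pi_apply v MeasurableSet.of_discrete)

lemma measurableSet_hitEvent (k : ℕ) : MeasurableSet (T.hitEvent b k) := by
  have : T.hitEvent b k = ⋃ w ∈ {w | T.label w = .leaf b}, {ω | T.position ω k = w} := by
    ext ω
    simp [hitEvent]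
  rw [this]
  exact MeasurableSet.biUnion (Set.to_countable _) fun w _ => measurableSet_position T k w

lemma hitEvent_monotone : Monotone (T.hitEvent b) := by
  refine monotone_nat_of_le_succ fun k ω hω => ?_
  rw [hitEvent, Set.mem_ofPred_eq] at hω ⊢
  rw [position_succ_of_leaf T hω, hω]

lemma setOf_outputs_eq_iUnion : {ω | T.Outputs ω b} = ⋃ k, T.hitEvent b k := by
  ext ω
  simp [Outputs, hitEvent]

lemma measurableSet_outputs : MeasurableSet {ω | ∃ b, T.Outputs ω b} := by
  have : {ω | ∃ b, T.Outputs ω b} = ⋃ b, {ω | T.Outputs ω b} := by ext ω; simp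
  rw [this]
  refine MeasurableSet.iUnion fun b => ?_
  rw [setOf_outputs_eq_iUnion]
  exact MeasurableSet.iUnion fun k => measurableSet_hitEvent T b k

lemma flipLaw_flipsAlong_inter_hitEvent_of_leaf (k : ℕ) (w : List Bool)
    (hw : ∀ v c, v ++ [c] <+: w → ∀ b', T.label v ≠ .leaf b') {b' : Bool}
    (hb : T.label w = .leaf b') :
    (T.flipLaw p).real (flipsAlong w ∩ T.hitEvent b (w.length + k)) =
      (T.flipLaw p).real (flipsAlong w) * T.hitProb p b k w := by
  have hpos : ∀ ω ∈ flipsAlong w, T.position ω (w.length + k) = w := by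
    intro ω hω
    have h1 := position_of_flipsAlong T hw hω
    rw [position_add_of_leaf T (b' := b'), h1]
    rw [h1, hb]
  rw [hitProb_of_leaf T p b hb]
  split_ifs with hbb
  · rw [mul_one]
    congr 1
    refine Set.inter_eq_left.2 fun ω hω => ?_
    rw [hitEvent, Set.mem_ofPred_eq, hpos ω hω, hb, hbb]
  · rw [mul_zero]
    have : flipsAlong w ∩ T.hitEvent b (w.length + k) = ∅ := by
      refine Set.eq_empty_of_forall_notMem fun ω hω => ?_
      have h2 := hω.2
      rw [hitEvent, Set.mem_ofPred_eq, hpos ω hω.1, hb] at h2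
      exact hbb (by simpa using h2)
    rw [this, measureReal_empty]

/-- If no leaf lies above `w`, then `hitProb` is the conditional probability of the output, given
that the execution passes through `w`. -/
lemma flipLaw_flipsAlong_inter_hitEvent (k : ℕ) (w : List Bool)
    (hw : ∀ v c, v ++ [c] <+: w → ∀ b', T.label v ≠ .leaf b') :
    (T.flipLaw p).real (flipsAlong w ∩ T.hitEvent b (w.length + k)) =
      (T.flipLaw p).real (flipsAlong w) * T.hitProb p b k w := by
  induction k generalizing w with
  | zero =>
    by_cases h : ∃ b', T.label w = .leaf b'
    · obtain ⟨b', hb⟩ := h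
      exact flipLaw_flipsAlong_inter_hitEvent_of_leaf T p b _ w hw hb
    · push Not at h
      have : flipsAlong w ∩ T.hitEvent b (w.length + 0) = ∅ := by
        refine Set.eq_empty_of_forall_notMem fun ω hω => ?_
        have h2 := hω.2
        rw [hitEvent, Set.mem_ofPred_eq, add_zero, position_of_flipsAlong T hw hω.1] at h2
        exact h b h2
      rw [this, measureReal_empty, hitProb_zero_of_not_leaf T p b h, mul_zero]
  | succ k ih =>
    by_cases h : ∃ b', T.label w = .leaf b'
    · obtain ⟨b', hb⟩ := h
      exact flipLaw_flipsAlong_inter_hitEvent_of_leaf T p b _ w hw hb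
    · push Not at h
      have hstep : ∀ c, (T.flipLaw p).real
          ({ω | ω w = c} ∩ flipsAlong w ∩ T.hitEvent b (w.length + (k + 1))) =
          (T.flipLaw p).real (flipsAlong (w ++ [c])) * T.hitProb p b k (w ++ [c]) := by
        intro c
        rw [← ih (w ++ [c]), flipsAlong_concat, List.length_append, List.length_singleton,
          add_assoc, add_comm 1 k]
        intro v d hv
        rcases List.prefix_concat_iff.1 hv with hv | hv
        · obtain ⟨rfl, -⟩ := List.append_inj' hv rfl
          exact h
        · exact hw v d hv
      have hm : MeasurableSet {ω : List Bool → Bool | ω w = true} :=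
        (measurableSet_singleton true).preimage (measurable_pi_apply w)
      rw [← measureReal_inter_add_sdiff hm, hitProb_succ_of_not_leaf T p b h]
      have h1 := hstep true
      have h2 := hstep false
      rw [flipLaw_flipsAlong_concat] at h1 h2
      have e1 : flipsAlong w ∩ T.hitEvent b (w.length + (k + 1)) ∩ {ω | ω w = true} =
          {ω | ω w = true} ∩ flipsAlong w ∩ T.hitEvent b (w.length + (k + 1)) := by
        ext ω; simp only [Set.mem_inter_iff]; tauto
      have e2 : (flipsAlong w ∩ T.hitEvent b (w.length + (k + 1))) \ {ω | ω w = true} =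
          {ω | ω w = false} ∩ flipsAlong w ∩ T.hitEvent b (w.length + (k + 1)) := by
        ext ω
        simp only [Set.mem_inter_iff, Set.mem_sdiff, Set.mem_ofPred_eq, Bool.not_eq_true]
        tauto
      rw [e1, e2, h1, h2]
      simp only [if_true, Bool.false_eq_true, if_false]
      ring

lemma flipLaw_hitEvent (k : ℕ) : (T.flipLaw p).real (T.hitEvent b k) = T.hitProb p b k [] := by
  have h := flipLaw_flipsAlong_inter_hitEvent T p b k [] (by simp)
  simpa [flipsAlong_nil] using h

lemma tendsto_hitProb :
    Tendsto (fun k => T.hitProb p b k []) atTop (𝓝 ((T.flipLaw p).real {ω | T.Outputs ω b})) := by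
  simp only [← flipLaw_hitEvent, setOf_outputs_eq_iUnion]
  exact (ENNReal.tendsto_toReal (measure_ne_top _ _)).comp
    (tendsto_measure_iUnion_atTop (hitEvent_monotone T b))

lemma tendsto_hitProb_add :
    Tendsto (fun k => T.hitProb p true k [] + T.hitProb p false k []) atTop
      (𝓝 ((T.flipLaw p).real {ω | ∃ b, T.Outputs ω b})) := by
  have hd : ∀ k, Disjoint (T.hitEvent true k) (T.hitEvent false k) := by
    intro k
    refine Set.disjoint_left.2 fun ω h1 h2 => ?_
    rw [hitEvent, Set.mem_ofPred_eq] at h1 h2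
    rw [h1] at h2
    simp at h2
  have he : {ω | ∃ b, T.Outputs ω b} = ⋃ k, (T.hitEvent true k ∪ T.hitEvent false k) := by
    rw [Set.iUnion_union_distrib, ← setOf_outputs_eq_iUnion, ← setOf_outputs_eq_iUnion]
    ext ω
    simp [or_comm]
  simp only [← flipLaw_hitEvent, he]
  simp only [← fun k => measureReal_union (μ := T.flipLaw p) (hd k)
    (measurableSet_hitEvent T false k)]
  exact (ENNReal.tendsto_toReal (measure_ne_top _ _)).comp
    (tendsto_measure_iUnion_atTop fun i j h =>
      Set.union_subset_union (hitEvent_monotone T true h) (hitEvent_monotone T false h))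

/-- The factory `T` outputs `1` with probability `g p` and `0` with probability `1 - g p`, in terms
of the limits of `hitProb`. -/
def Computes (g : Cube n → ℝ) : Prop :=
  ∀ p b, Tendsto (fun k => T.hitProb p b k []) atTop (𝓝 (if b then g p else 1 - g p))

theorem implements_iff_computes (f : Cube n → unitInterval) :
    T.Implements f ↔ T.Computes fun p => f p := by
  constructor
  · rintro ⟨hv, hf⟩ p b
    have h1 := tendsto_hitProb T p true
    rw [hf] at h1
    cases b
    · have h2 := tendsto_hitProb_add T p
      have hone : (T.flipLaw p).real {ω | ∃ b, T.Outputs ω b} = 1 := by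
        rw [measureReal_def, (mem_ae_iff_prob_eq_one (measurableSet_outputs T)).1 (hv p),
          ENNReal.toReal_one]
      rw [hone] at h2
      simpa using h2.sub h1
    · simpa using h1
  · intro h
    refine ⟨fun p => ?_, fun p => ?_⟩
    · have h1 := (h p true).add (h p false)
      have h2 := tendsto_nhds_unique (tendsto_hitProb_add T p) h1
      simp only [if_true, Bool.false_eq_true, if_false, add_sub_cancel] at h2
      refine (mem_ae_iff_prob_eq_one (measurableSet_outputs T)).2 ?_
      rwa [measureReal_def, ENNReal.toReal_eq_one_iff] at h2
    · simpa using tendsto_nhds_unique (tendsto_hitProb T p true) (h p true)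

end Factory
/-! ### Functions that can be implemented are continuous and polynomially bounded -/

/-- The polynomial of a face as a product over the coins: the factors that remain are those of the
outcomes that have positive probability on the face. -/
lemma facePoly_eq_prod {A S B : Finset (Fin n)} (h : IsPartition A S B) (p : Cube n) :
    facePoly A S B p =
      ∏ i, (if i ∈ B then 1 else 1 - (p i : ℝ)) * (if i ∈ A then 1 else (p i : ℝ)) := by
  obtain ⟨hAS, hAB, hSB, hU⟩ := h
  have e : ∀ (C : Finset (Fin n)) (g : Fin n → ℝ),
      ∏ i ∈ C, g i = ∏ i, if i ∈ C then g i else 1 := by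
    intro C g
    rw [Finset.prod_ite_mem, Finset.univ_inter]
  rw [facePoly, e A, e S, e S, e B, ← Finset.prod_mul_distrib, ← Finset.prod_mul_distrib,
    ← Finset.prod_mul_distrib]
  refine Finset.prod_congr rfl fun i _ => ?_
  have hi : i ∈ A ∪ S ∪ B := hU ▸ Finset.mem_univ i
  rw [Finset.disjoint_left] at hAS hAB hSB
  rcases Finset.mem_union.1 hi with hi | hi
  · rcases Finset.mem_union.1 hi with hi | hi
    · simp [hi, hAS hi, hAB hi]
    · have : i ∉ A := fun h => hAS h hi
      simp [hi, this, hSB hi, mul_comm]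
  · have h1 : i ∉ A := fun h => hAB h hi
    have h2 : i ∉ S := fun h => hSB h hi
    simp [hi, h1, h2]

lemma faceFactor_mem_Icc (A B : Finset (Fin n)) (p : Cube n) (i : Fin n) :
    (if i ∈ B then 1 else 1 - (p i : ℝ)) * (if i ∈ A then 1 else (p i : ℝ)) ∈
      Set.Icc (0 : ℝ) 1 := by
  have h0 : (0 : ℝ) ≤ p i := (p i).2.1
  have h1 : (p i : ℝ) ≤ 1 := (p i).2.2
  constructor
  · split_ifs <;> nlinarith
  · split_ifs <;> nlinarith

lemma facePoly_nonneg {A S B : Finset (Fin n)} (h : IsPartition A S B) (p : Cube n) :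
    0 ≤ facePoly A S B p := by
  rw [facePoly_eq_prod h]
  exact Finset.prod_nonneg fun i _ => (faceFactor_mem_Icc A B p i).1

lemma facePoly_le_faceFactor {A S B : Finset (Fin n)} (h : IsPartition A S B) (p : Cube n)
    (i : Fin n) : facePoly A S B p ≤
      (if i ∈ B then 1 else 1 - (p i : ℝ)) * (if i ∈ A then 1 else (p i : ℝ)) := by
  rw [facePoly_eq_prod h, ← Finset.mul_prod_erase _ _ (Finset.mem_univ i)]
  exact mul_le_of_le_one_right (faceFactor_mem_Icc A B p i).1
    (Finset.prod_le_one (fun j _ => (faceFactor_mem_Icc A B p j).1)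
      fun j _ => (faceFactor_mem_Icc A B p j).2)

lemma facePoly_le_one {A S B : Finset (Fin n)} (h : IsPartition A S B) (p : Cube n) :
    facePoly A S B p ≤ 1 := by
  rw [facePoly_eq_prod h]
  exact Finset.prod_le_one (fun j _ => (faceFactor_mem_Icc A B p j).1)
      fun j _ => (faceFactor_mem_Icc A B p j).2

lemma facePoly_le_self {A S B : Finset (Fin n)} (h : IsPartition A S B) (p : Cube n) {i : Fin n}
    (hi : i ∉ A) : facePoly A S B p ≤ p i := by
  refine (facePoly_le_faceFactor h p i).trans ?_
  have h0 : (0 : ℝ) ≤ p i := (p i).2.1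
  rw [if_neg hi]
  split_ifs <;> nlinarith

lemma facePoly_le_one_sub {A S B : Finset (Fin n)} (h : IsPartition A S B) (p : Cube n) {i : Fin n}
    (hi : i ∉ B) : facePoly A S B p ≤ 1 - p i := by
  refine (facePoly_le_faceFactor h p i).trans ?_
  have h1 : (p i : ℝ) ≤ 1 := (p i).2.2
  rw [if_neg hi]
  split_ifs <;> nlinarith

/-- An outcome that is possible at one point of a face is reached along a path whose probability
at every point is a constant times a product of factors of `facePoly`. -/
lemma Factory.exists_mul_facePoly_pow_le_hitProb (T : Factory n) {A S B : Finset (Fin n)}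
    (h : IsPartition A S B) {q : Cube n} (hq : q ∈ openFace A S B) (b : Bool) (k : ℕ)
    (w : List Bool) (hpos : 0 < T.hitProb q b k w) :
    ∃ c : ℝ, 0 < c ∧ ∀ p, c * facePoly A S B p ^ k ≤ T.hitProb p b k w := by
  have hleaf : ∀ k w b', T.label w = .leaf b' → 0 < T.hitProb q b k w →
      ∃ c : ℝ, 0 < c ∧ ∀ p, c * facePoly A S B p ^ k ≤ T.hitProb p b k w := by
    intro k w b' hb hpos
    rw [hitProb_of_leaf T q b hb] at hpos
    refine ⟨1, one_pos, fun p => ?_⟩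
    have hbb : b' = b := by
      by_contra hne
      simp [hne] at hpos
    rw [hitProb_of_leaf T p b hb, if_pos hbb, one_mul]
    exact pow_le_one₀ (facePoly_nonneg h p) (facePoly_le_one h p)
  induction k generalizing w with
  | zero =>
    by_cases hw : ∃ b', T.label w = .leaf b'
    · obtain ⟨b', hb⟩ := hw
      exact hleaf _ w b' hb hpos
    · push Not at hw
      rw [hitProb_zero_of_not_leaf T q b hw] at hpos
      exact absurd hpos (lt_irrefl _)
  | succ k ih =>
    by_cases hw : ∃ b', T.label w = .leaf b'
    · obtain ⟨b', hb⟩ := hw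
      exact hleaf _ w b' hb hpos
    · push Not at hw
      have key : ∀ (x : Bool) (d : ℝ), 0 < d →
          0 < T.hitProb q b k (w ++ [x]) → (∀ p, d * facePoly A S B p ≤
            (if x then (T.bias p w : ℝ) else 1 - T.bias p w)) →
          ∃ c : ℝ, 0 < c ∧ ∀ p, c * facePoly A S B p ^ (k + 1) ≤ T.hitProb p b (k + 1) w := by
        intro x d hd hx hdp
        obtain ⟨c, hc, hcp⟩ := ih _ hx
        refine ⟨c * d, mul_pos hc hd, fun p => ?_⟩
        have hF := facePoly_nonneg h p
        have h1 : c * d * facePoly A S B p ^ (k + 1) ≤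
            (if x then (T.bias p w : ℝ) else 1 - T.bias p w) * T.hitProb p b k (w ++ [x]) := by
          calc c * d * facePoly A S B p ^ (k + 1)
              = (d * facePoly A S B p) * (c * facePoly A S B p ^ k) := by ring
            _ ≤ _ := mul_le_mul (hdp p) (hcp p) (by positivity)
                ((mul_nonneg hd.le hF).trans (hdp p))
        refine h1.trans ?_
        rw [hitProb_succ_of_not_leaf T p b hw]
        have ht := mul_nonneg (T.bias p w).2.1 (T.hitProb_nonneg p b k (w ++ [true]))
        have hf := mul_nonneg (sub_nonneg.2 (T.bias p w).2.2)
          (T.hitProb_nonneg p b k (w ++ [false]))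
        cases x
        · simpa using ht
        · simpa using hf
      rw [hitProb_succ_of_not_leaf T q b hw] at hpos
      have hx : ∃ x, 0 < (if x then (T.bias q w : ℝ) else 1 - T.bias q w) ∧
          0 < T.hitProb q b k (w ++ [x]) := by
        by_contra! hcon
        have ht := hcon true
        have hf := hcon false
        simp only [if_true, Bool.false_eq_true, if_false] at ht hf
        have ht' : (T.bias q w : ℝ) * T.hitProb q b k (w ++ [true]) ≤ 0 := by
          rcases (T.bias q w).2.1.eq_or_lt with h0 | h0
          · rw [← h0, zero_mul]
          · exact mul_nonpos_of_nonneg_of_nonpos h0.le (ht h0)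
        have hf' : (1 - (T.bias q w : ℝ)) * T.hitProb q b k (w ++ [false]) ≤ 0 := by
          rcases (sub_nonneg.2 (T.bias q w).2.2).eq_or_lt with h0 | h0
          · rw [← h0, zero_mul]
          · exact mul_nonpos_of_nonneg_of_nonpos h0.le (hf h0)
        linarith
      obtain ⟨x, hx1, hx2⟩ := hx
      cases hl : T.label w with
      | leaf b' => exact absurd hl (hw b')
      | const c hc =>
        have hbias : ∀ p, T.bias p w = c := fun p => by rw [bias, hl]
        rw [hbias] at hx1
        refine key x _ hx1 hx2 fun p => ?_
        rw [hbias]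
        exact mul_le_of_le_one_right hx1.le (facePoly_le_one h p)
      | coin i =>
        have hbias : ∀ p, T.bias p w = p i := fun p => by rw [bias, hl]
        rw [hbias] at hx1
        refine key x 1 one_pos hx2 fun p => ?_
        rw [hbias, one_mul]
        cases x
        · simp only [Bool.false_eq_true, if_false] at hx1 ⊢
          refine facePoly_le_one_sub h p fun hi => ?_
          rw [hq.2.2 i hi] at hx1
          simp at hx1
        · simp only [if_true] at hx1 ⊢
          refine facePoly_le_self h p fun hi => ?_
          rw [hq.1 i hi] at hx1
          simp at hx1

/-- The exponent and the constant may depend on the face, as there are finitely many faces. -/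
lemma polynomiallyBounded_of_forall_face {f : Cube n → unitInterval}
    (hf : ∀ A S B : Finset (Fin n), IsPartition A S B → (¬ ∀ q ∈ openFace A S B, f q = 0) →
      ∃ m : ℕ, ∃ c : ℝ, 0 < c ∧ ∀ p, c * facePoly A S B p ^ m ≤ (f p : ℝ)) :
    PolynomiallyBounded f := by
  have hf' : ∀ F : Finset (Fin n) × Finset (Fin n) × Finset (Fin n),
      ∃ m : ℕ, ∃ c : ℝ, 0 < c ∧ (IsPartition F.1 F.2.1 F.2.2 →
        (¬ ∀ q ∈ openFace F.1 F.2.1 F.2.2, f q = 0) →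
        ∀ p, c * facePoly F.1 F.2.1 F.2.2 p ^ m ≤ (f p : ℝ)) := by
    intro F
    by_cases h : IsPartition F.1 F.2.1 F.2.2 ∧ ¬ ∀ q ∈ openFace F.1 F.2.1 F.2.2, f q = 0
    · obtain ⟨m, c, hc, hp⟩ := hf _ _ _ h.1 h.2
      exact ⟨m, c, hc, fun _ _ => hp⟩
    · exact ⟨0, 1, one_pos, fun h1 h2 => absurd ⟨h1, h2⟩ h⟩
  choose m c hc hp using hf'
  obtain ⟨M, hM⟩ := Finite.exists_le m
  obtain ⟨F₀, hF₀⟩ := Finite.exists_min c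
  refine ⟨M, c F₀, hc F₀, fun A S B hP hne p => ?_⟩
  refine le_trans ?_ (hp (A, S, B) hP hne p)
  exact mul_le_mul (hF₀ _) (pow_le_pow_of_le_one (facePoly_nonneg hP p) (facePoly_le_one hP p)
    (hM (A, S, B))) (pow_nonneg (facePoly_nonneg hP p) _) (hc _).le

lemma Factory.polynomiallyBounded_of_tendsto (T : Factory n) (b : Bool) {f : Cube n → unitInterval}
    (hf : ∀ p, Tendsto (fun k => T.hitProb p b k []) atTop (𝓝 (f p : ℝ))) :
    PolynomiallyBounded f := by
  refine polynomiallyBounded_of_forall_face fun A S B h hne => ?_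
  push Not at hne
  obtain ⟨q, hq, hfq⟩ := hne
  have hpos : (0 : ℝ) < f q := unitInterval.coe_pos.2 (unitInterval.pos_iff_ne_zero.2 hfq)
  obtain ⟨k, hk⟩ := ((hf q).eventually (lt_mem_nhds hpos)).exists
  obtain ⟨c, hc, hcp⟩ := T.exists_mul_facePoly_pow_le_hitProb h hq b k [] hk
  exact ⟨k, c, hc, fun p => (hcp p).trans ((T.hitProb_monotone p b []).ge_of_tendsto (hf p) k)⟩

/-- A limit of an increasing sequence of continuous functions is lower semicontinuous. -/
lemma Factory.eventually_lt_of_tendsto (T : Factory n) (b : Bool) {f : Cube n → ℝ}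
    (hf : ∀ p, Tendsto (fun k => T.hitProb p b k []) atTop (𝓝 (f p))) {a : ℝ} {q : Cube n}
    (ha : a < f q) : ∀ᶠ p in 𝓝 q, a < f p := by
  obtain ⟨k, hk⟩ := ((hf q).eventually (lt_mem_nhds ha)).exists
  filter_upwards [(T.continuous_hitProb b k []).continuousAt.eventually (lt_mem_nhds hk)] with p hp
  exact hp.trans_le ((T.hitProb_monotone p b []).ge_of_tendsto (hf p) k)

lemma Factory.Computes.continuous {T : Factory n} {g : Cube n → ℝ} (h : T.Computes g) :
    Continuous g := by
  refine continuous_iff_continuousAt.2 fun q => tendsto_order.2 ⟨fun a ha => ?_, fun a ha => ?_⟩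
  · exact T.eventually_lt_of_tendsto true (fun p => by simpa using h p true) ha
  · have := T.eventually_lt_of_tendsto (f := fun p => 1 - g p) false
      (fun p => by simpa using h p false) (sub_lt_sub_left ha 1)
    filter_upwards [this] with p hp
    linarith

theorem Factory.Computes.polynomiallyBounded {T : Factory n} {f : Cube n → unitInterval}
    (h : T.Computes fun p => f p) :
    PolynomiallyBounded f ∧ PolynomiallyBounded (fun p => unitInterval.symm (f p)) :=
  ⟨T.polynomiallyBounded_of_tendsto true fun p => by simpa using h p true,
    T.polynomiallyBounded_of_tendsto false fun p => by simpa using h p false⟩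

/-! ### Combining factories -/

namespace Factory

/-- The factory that outputs `b` without any flip. -/
def output (n : ℕ) (b : Bool) : Factory n := ⟨fun _ => .leaf b⟩

lemma computes_output (b : Bool) : (output n b).Computes fun _ => if b then 1 else 0 := by
  intro p b'
  have : ∀ k, (output n b).hitProb p b' k [] = if b = b' then 1 else 0 :=
    hitProb_of_leaf (output n b) p b' rfl
  simp only [this]
  cases b <;> cases b' <;> simp

variable {T : Factory n} {p : Cube n}

lemma hitProb_cons {T' : Factory n} {x : Bool} (h : ∀ w, T.label (x :: w) = T'.label w) (b : Bool)
    (k : ℕ) (w : List Bool) : T.hitProb p b k (x :: w) = T'.hitProb p b k w := by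
  have hbias : ∀ w, T.bias p (x :: w) = T'.bias p w := fun w => by rw [bias, bias, h]
  induction k generalizing w with
  | zero => rw [hitProb, hitProb, h]
  | succ k ih => simp only [hitProb, h, hbias, List.cons_append, ih]

/-- The output probabilities of a factory in terms of those of the two subtrees below its root. -/
lemma hitProb_succ_nil {T₁ T₀ : Factory n} (hroot : ∀ b, T.label [] ≠ .leaf b)
    (h₁ : ∀ w, T.label (true :: w) = T₁.label w) (h₀ : ∀ w, T.label (false :: w) = T₀.label w)
    (b : Bool) (k : ℕ) : T.hitProb p b (k + 1) [] =
      T.bias p [] * T₁.hitProb p b k [] + (1 - T.bias p []) * T₀.hitProb p b k [] := by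
  rw [hitProb_succ_of_not_leaf T p b hroot, List.nil_append, List.nil_append, hitProb_cons h₁,
    hitProb_cons h₀]

/-- The factory that flips the coin `i` and goes on with `T₁` or `T₀` according to the result. -/
def coinNode (i : Fin n) (T₁ T₀ : Factory n) : Factory n where
  label
    | [] => .coin i
    | true :: w => T₁.label w
    | false :: w => T₀.label w

lemma computes_coinNode (i : Fin n) {T₁ T₀ : Factory n} {g₁ g₀ : Cube n → ℝ} (h₁ : T₁.Computes g₁)
    (h₀ : T₀.Computes g₀) :
    (coinNode i T₁ T₀).Computes fun p => p i * g₁ p + (1 - p i) * g₀ p := by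
  intro p b
  rw [← tendsto_add_atTop_iff_nat 1]
  have : ∀ k, (coinNode i T₁ T₀).hitProb p b (k + 1) [] =
      p i * T₁.hitProb p b k [] + (1 - p i) * T₀.hitProb p b k [] :=
    hitProb_succ_nil (T := coinNode i T₁ T₀) (by simp [coinNode]) (fun _ => rfl) (fun _ => rfl) b
  simp only [this]
  have := ((h₁ p b).const_mul (p i : ℝ)).add ((h₀ p b).const_mul (1 - p i : ℝ))
  convert this using 2
  cases b
  · simp only [Bool.false_eq_true, if_false]; ring
  · rfl

/-- The labels of `mixture c hc T j`, by recursion on the address: the root flips a coin of bias `c`,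
its right subtree is `T j`, and its left subtree is the mixture that starts with `T (j + 1)`. -/
def mixtureLabel (c : unitInterval) (hc : 0 < c ∧ c < 1) (T : ℕ → Factory n) :
    ℕ → List Bool → NodeLabel n
  | _, [] => .const c hc
  | j, true :: w => (T j).label w
  | j, false :: w => mixtureLabel c hc T (j + 1) w

/-- The factory that flips a coin of bias `c` until it shows `1`, and then goes on with `T (j + i)`
where `i` is the number of zeros. -/
def mixture (c : unitInterval) (hc : 0 < c ∧ c < 1) (T : ℕ → Factory n) (j : ℕ) : Factory n :=
  ⟨mixtureLabel c hc T j⟩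

lemma exists_tendsto_hitProb (T : Factory n) (p : Cube n) (b : Bool) :
    ∃ l ∈ Set.Icc (0 : ℝ) 1, Tendsto (fun k => T.hitProb p b k []) atTop (𝓝 l) := by
  have h := tendsto_atTop_ciSup (T.hitProb_monotone p b [])
    ⟨1, by rintro _ ⟨k, rfl⟩; exact T.hitProb_le_one p b k []⟩
  exact ⟨_, ⟨ge_of_tendsto' h fun k => T.hitProb_nonneg p b k [],
    le_of_tendsto' h fun k => T.hitProb_le_one p b k []⟩, h⟩

/-- A bounded sequence that satisfies a homogeneous recursion with contraction factor `1 - c`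
vanishes. -/
lemma eq_zero_of_forall_eq_mul_succ {c : ℝ} (hc0 : 0 < c) (hc1 : c < 1) {u : ℕ → ℝ} {C : ℝ}
    (hu : ∀ j, |u j| ≤ C) (h : ∀ j, u j = (1 - c) * u (j + 1)) : u 0 = 0 := by
  have hpow : ∀ j, u 0 = (1 - c) ^ j * u j := by
    intro j
    induction j with
    | zero => simp
    | succ j ih => rw [ih, h j, pow_succ, mul_assoc]
  have hlim : Tendsto (fun j => (1 - c) ^ j * C) atTop (𝓝 (0 * C)) :=
    (tendsto_pow_atTop_nhds_zero_of_lt_one (by linarith) (by linarith)).mul_const C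
  rw [zero_mul] at hlim
  have : |u 0| ≤ 0 := by
    refine ge_of_tendsto' hlim fun j => ?_
    rw [hpow j, abs_mul, abs_of_nonneg (pow_nonneg (by linarith) j)]
    exact mul_le_mul_of_nonneg_left (hu j) (pow_nonneg (by linarith) j)
  exact abs_nonpos_iff.1 this

lemma computes_mixture (c : unitInterval) (hc : 0 < c ∧ c < 1) {T : ℕ → Factory n}
    {g f : ℕ → Cube n → ℝ} (hT : ∀ j, (T j).Computes (g j)) (hf : ∀ j p, f j p ∈ Set.Icc (0 : ℝ) 1)
    (hfg : ∀ j p, f j p = c * g j p + (1 - c) * f (j + 1) p) :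
    (mixture c hc T 0).Computes (f 0) := by
  intro p b
  choose l hl htl using fun j => exists_tendsto_hitProb (mixture c hc T j) p b
  have hlrec : ∀ j, l j = c * (if b then g j p else 1 - g j p) + (1 - c) * l (j + 1) := by
    intro j
    have h1 : ∀ k, (mixture c hc T j).hitProb p b (k + 1) [] =
        c * (T j).hitProb p b k [] + (1 - c) * (mixture c hc T (j + 1)).hitProb p b k [] :=
      hitProb_succ_nil (T := mixture c hc T j) (by simp [mixture, mixtureLabel]) (fun _ => rfl)
        (fun _ => rfl) b
    have h2 := (tendsto_add_atTop_iff_nat 1).2 (htl j)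
    simp only [h1] at h2
    exact tendsto_nhds_unique h2
      (((hT j p b).const_mul (c : ℝ)).add ((htl (j + 1)).const_mul (1 - c : ℝ)))
  have h0 : l 0 - (if b then f 0 p else 1 - f 0 p) = 0 := by
    refine eq_zero_of_forall_eq_mul_succ (c := c) (C := 1)
      (u := fun j => l j - (if b then f j p else 1 - f j p))
      (unitInterval.coe_pos.2 hc.1) (unitInterval.coe_lt_one.2 hc.2) (fun j => ?_) fun j => ?_
    · have h1 := hl j
      have h2 := hf j p
      cases b
      · simp only [Bool.false_eq_true, if_false]
        exact abs_le.2 ⟨by linarith [h1.1, h2.1], by linarith [h1.2, h2.2]⟩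
      · simp only [if_true]
        exact abs_le.2 ⟨by linarith [h1.1, h2.2], by linarith [h1.2, h2.1]⟩
    · cases b
      · have := hlrec j
        simp only [Bool.false_eq_true, if_false] at this ⊢
        rw [this, hfg j p]; ring
      · have := hlrec j
        simp only [if_true] at this ⊢
        rw [this, hfg j p]; ring
  rw [← sub_eq_zero.1 h0]
  exact htl 0

end Factory

/-! ### Finitely many independent flips -/

/-- The probability that independent coins of biases `q` show `ω`. -/
def flipWeight {M : ℕ} (q : Fin M → ℝ) (ω : Fin M → Bool) : ℝ :=
  ∏ x, if ω x then q x else 1 - q x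

/-- The expectation of `F` under independent flips of coins of biases `q`. -/
def flipExp {M : ℕ} (q : Fin M → ℝ) (F : (Fin M → Bool) → ℝ) : ℝ :=
  ∑ ω, flipWeight q ω * F ω

section flipExp

variable {M : ℕ} {q : Fin M → ℝ}

lemma flipExp_succ (q : Fin (M + 1) → ℝ) (F : (Fin (M + 1) → Bool) → ℝ) :
    flipExp q F = q 0 * flipExp (fun x => q x.succ) (fun ω => F (Fin.cons true ω)) +
      (1 - q 0) * flipExp (fun x => q x.succ) (fun ω => F (Fin.cons false ω)) := by
  simp only [flipExp, flipWeight]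
  rw [← (Fin.consEquiv fun _ : Fin (M + 1) => Bool).sum_comp, Fintype.sum_prod_type,
    Fintype.sum_bool, Finset.mul_sum, Finset.mul_sum]
  simp [Fin.consEquiv, Fin.prod_univ_succ, mul_assoc]

lemma flipExp_zero (q : Fin 0 → ℝ) (F : (Fin 0 → Bool) → ℝ) : flipExp q F = F Fin.elim0 := by
  simpa [flipExp, flipWeight] using congrArg F (Subsingleton.elim _ _)

lemma flipExp_one (q : Fin M → ℝ) : flipExp q (fun _ => 1) = 1 := by
  induction M with
  | zero => simp [flipExp_zero]
  | succ M ih => rw [flipExp_succ, ih]; ring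

lemma flipWeight_nonneg (hq : ∀ x, q x ∈ Set.Icc (0 : ℝ) 1) (ω : Fin M → Bool) :
    0 ≤ flipWeight q ω := by
  refine Finset.prod_nonneg fun x _ => ?_
  split_ifs
  · exact (hq x).1
  · exact sub_nonneg.2 (hq x).2

lemma flipExp_mono (hq : ∀ x, q x ∈ Set.Icc (0 : ℝ) 1) {F G : (Fin M → Bool) → ℝ}
    (h : ∀ ω, F ω ≤ G ω) : flipExp q F ≤ flipExp q G :=
  Finset.sum_le_sum fun ω _ => mul_le_mul_of_nonneg_left (h ω) (flipWeight_nonneg hq ω)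

lemma flipExp_one_sub (q : Fin M → ℝ) (F : (Fin M → Bool) → ℝ) :
    flipExp q (fun ω => 1 - F ω) = 1 - flipExp q F := by
  have h := flipExp_one q
  simp only [flipExp, mul_sub, Finset.sum_sub_distrib] at h ⊢
  rw [h]

lemma flipExp_sum_mul {ι : Type*} (s : Finset ι) (a : ℝ) (F : ι → (Fin M → Bool) → ℝ) :
    flipExp q (fun ω => ∑ i ∈ s, a * F i ω) = ∑ i ∈ s, a * flipExp q (F i) := by
  simp only [flipExp, Finset.mul_sum]
  rw [Finset.sum_comm]
  exact Finset.sum_congr rfl fun i _ => Finset.sum_congr rfl fun ω _ => by ring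

/-- The second moment of a constant plus a linear combination of centred independent flips. -/
lemma flipExp_sq (q : Fin M → ℝ) (s : ℝ) (a : Fin M → ℝ) :
    flipExp q (fun ω => (s + ∑ x, a x * ((if ω x then 1 else 0) - q x)) ^ 2) =
      s ^ 2 + ∑ x, a x ^ 2 * (q x * (1 - q x)) := by
  induction M generalizing s with
  | zero => simp [flipExp_zero]
  | succ M ih =>
    rw [flipExp_succ]
    simp only [Fin.sum_univ_succ, Fin.cons_zero, Fin.cons_succ, ← add_assoc, ih]
    simp only [if_true, Bool.false_eq_true, if_false]
    ring

/-- Every event that depends on finitely many flips of the input coins can be decided by a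
factory. -/
lemma exists_computes_flipExp (c : Fin M → Fin n) (D : (Fin M → Bool) → Prop) [DecidablePred D] :
    ∃ T : Factory n, T.Computes fun p =>
      flipExp (fun x => (p (c x) : ℝ)) fun ω => if D ω then 1 else 0 := by
  induction M with
  | zero =>
    refine ⟨Factory.output n (decide (D Fin.elim0)), ?_⟩
    simpa [flipExp_zero] using Factory.computes_output (n := n) (decide (D Fin.elim0))
  | succ M ih =>
    obtain ⟨T₁, h₁⟩ := ih (fun x => c x.succ) (fun ω => D (Fin.cons true ω))
    obtain ⟨T₀, h₀⟩ := ih (fun x => c x.succ) (fun ω => D (Fin.cons false ω))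
    refine ⟨Factory.coinNode (c 0) T₁ T₀, ?_⟩
    simp only [flipExp_succ]
    exact Factory.computes_coinNode (c 0) h₁ h₀

end flipExp

/-! ### Rounded empirical frequencies -/

section rounding

variable {M : ℕ}

/-- The number of flips of the coin `i` with result `b`, when flip `x` is one of the coin `c x`. -/
def count (c : Fin M → Fin n) (ω : Fin M → Bool) (b : Bool) (i : Fin n) : ℕ :=
  (Finset.univ.filter fun x => c x = i ∧ ω x = b).card

/-- The empirical frequencies of ones, rounded to `0` for a coin with fewer than `L` ones and to `1`
for a coin with fewer than `L` zeros. -/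
def roundedFreq (L : ℕ) (c : Fin M → Fin n) (ω : Fin M → Bool) : Cube n := fun i =>
  if count c ω true i < L then 0
  else if count c ω false i < L then 1
  else ⟨count c ω true i / (count c ω true i + count c ω false i),
    unitInterval.div_mem (by positivity) (by positivity) (by simp)⟩

variable {c : Fin M → Fin n} {ω : Fin M → Bool} {N L R : ℕ}

lemma count_add_count (i : Fin n) :
    count c ω true i + count c ω false i = (Finset.univ.filter fun x => c x = i).card := by
  rw [count, count, ← Finset.card_union_of_disjoint]
  · congr 1
    ext x
    simp only [Finset.mem_union, Finset.mem_filter, Finset.mem_univ, true_and]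
    cases ω x <;> simp
  · refine Finset.disjoint_filter.2 fun x _ h1 h2 => ?_
    rw [h1.2] at h2
    simp at h2

lemma flipWeight_eq_prod (c : Fin M → Fin n) (ω : Fin M → Bool) (p : Cube n) :
    flipWeight (fun x => (p (c x) : ℝ)) ω =
      ∏ i, (p i : ℝ) ^ count c ω true i * (1 - (p i : ℝ)) ^ count c ω false i := by
  rw [flipWeight, ← Finset.prod_fiberwise (s := Finset.univ) (g := c)]
  refine Finset.prod_congr rfl fun i _ => ?_
  rw [Finset.prod_ite, count, count, ← Finset.prod_const, ← Finset.prod_const,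
    Finset.filter_filter, Finset.filter_filter]
  congr 1
  · refine Finset.prod_congr rfl fun x hx => ?_
    rw [(Finset.mem_filter.1 hx).2.1]
  · simp only [Bool.not_eq_true]
    refine Finset.prod_congr rfl fun x hx => ?_
    rw [(Finset.mem_filter.1 hx).2.1]

/-- The probability of the flips is at most the `L`-th power of the polynomial of the open face on
which the rounded frequencies lie: each result that is possible on the face was seen at least `L`
times. -/
lemma exists_face_roundedFreq (hL : 0 < L) (hR : 2 ≤ R)
    (hc : ∀ i, (Finset.univ.filter fun x => c x = i).card = R * L) :
    ∃ A S B : Finset (Fin n), IsPartition A S B ∧ roundedFreq L c ω ∈ openFace A S B ∧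
      ∀ p : Cube n, flipWeight (fun x => (p (c x) : ℝ)) ω ≤ facePoly A S B p ^ L := by
  have hcount : ∀ i, 2 * L ≤ count c ω true i + count c ω false i := fun i => by
    rw [count_add_count, hc]
    exact Nat.mul_le_mul_right L hR
  have hP : IsPartition (Finset.univ.filter fun i => count c ω true i < L)
    (Finset.univ.filter fun i => L ≤ count c ω true i ∧ L ≤ count c ω false i)
    (Finset.univ.filter fun i => count c ω false i < L) := by
    refine ⟨?_, ?_, ?_, ?_⟩
    · exact Finset.disjoint_filter.2 fun i _ h1 h2 => by omega
    · exact Finset.disjoint_filter.2 fun i _ h1 h2 => by have := hcount i; omega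
    · exact Finset.disjoint_filter.2 fun i _ h1 h2 => by omega
    · ext i
      simp only [Finset.mem_union, Finset.mem_filter, Finset.mem_univ, true_and, iff_true]
      omega
  refine ⟨_, _, _, hP, ⟨fun i hi => ?_, fun i hi => ?_, fun i hi => ?_⟩, fun p => ?_⟩
  · rw [Finset.mem_filter] at hi
    rw [roundedFreq, if_pos hi.2]
  · rw [Finset.mem_filter] at hi
    rw [roundedFreq, if_neg (by omega), if_neg (by omega)]
    have h1 : (0 : ℝ) < count c ω true i := by exact_mod_cast hL.trans_le hi.2.1
    have h2 : (0 : ℝ) < count c ω false i := by exact_mod_cast hL.trans_le hi.2.2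
    constructor
    · rw [← unitInterval.coe_pos]
      positivity
    · rw [← unitInterval.coe_lt_one]
      exact (div_lt_one (by positivity)).2 (by linarith)
  · rw [Finset.mem_filter] at hi
    have := hcount i
    rw [roundedFreq, if_neg (by omega), if_pos hi.2]
  · rw [flipWeight_eq_prod, facePoly_eq_prod hP, ← Finset.prod_pow]
    have h0 : ∀ i, (0 : ℝ) ≤ p i := fun i => (p i).2.1
    have h1 : ∀ i, (p i : ℝ) ≤ 1 := fun i => (p i).2.2
    have h2 : ∀ i, (0 : ℝ) ≤ 1 - p i := fun i => sub_nonneg.2 (h1 i)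
    have h3 : ∀ i, 1 - (p i : ℝ) ≤ 1 := fun i => sub_le_self _ (h0 i)
    refine Finset.prod_le_prod (fun i _ => mul_nonneg (pow_nonneg (h0 i) _) (pow_nonneg (h2 i) _))
      fun i _ => ?_
    rw [mul_pow, mul_comm]
    refine mul_le_mul ?_ ?_ (pow_nonneg (h0 i) _) (pow_nonneg ?_ _)
    · simp only [Finset.mem_filter, Finset.mem_univ, true_and]
      split_ifs with h
      · rw [one_pow]; exact pow_le_one₀ (h2 i) (h3 i)
      · exact pow_le_pow_of_le_one (h2 i) (h3 i) (by omega)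
    · simp only [Finset.mem_filter, Finset.mem_univ, true_and]
      split_ifs with h
      · rw [one_pow]; exact pow_le_one₀ (h0 i) (h1 i)
      · exact pow_le_pow_of_le_one (h0 i) (h1 i) (by omega)
    · split_ifs
      · exact zero_le_one
      · exact h2 i

lemma abs_roundedFreq_sub_le (hL : 0 < L) (hR : 2 ≤ R)
    (hc : ∀ i, (Finset.univ.filter fun x => c x = i).card = R * L) (i : Fin n) :
    |(roundedFreq L c ω i : ℝ) - count c ω true i / (R * L : ℕ)| ≤ 1 / R := by
  have hsum : (count c ω true i : ℝ) + count c ω false i = (R * L : ℕ) := by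
    exact_mod_cast (count_add_count i).trans (hc i)
  have hR' : (0 : ℝ) < R := by exact_mod_cast (by omega : 0 < R)
  have hL' : (0 : ℝ) < L := by exact_mod_cast hL
  rw [Nat.cast_mul] at *
  have e : (1 : ℝ) / R = L / (R * L) := by field_simp
  rw [roundedFreq]
  split_ifs with h1 h2
  · have h1' : (count c ω true i : ℝ) ≤ L := by exact_mod_cast h1.le
    rw [Set.Icc.coe_zero, zero_sub, abs_neg, abs_of_nonneg (by positivity), e]
    gcongr
  · have h2' : (count c ω false i : ℝ) ≤ L := by exact_mod_cast h2.le
    have : (1 : ℝ) - count c ω true i / (R * L) = count c ω false i / (R * L) := by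
      rw [← hsum]
      have : (0 : ℝ) < count c ω true i + count c ω false i := by rw [hsum]; positivity
      field_simp
      ring
    rw [Set.Icc.coe_one, this, abs_of_nonneg (by positivity), e]
    gcongr
  · simp only [hsum, sub_self, abs_zero]
    positivity

/-- The variance of an empirical frequency. -/
lemma flipExp_count_div_sub_sq_le (hN : 0 < N)
    (hc : ∀ i, (Finset.univ.filter fun x => c x = i).card = N) (p : Cube n) (i : Fin n) :
    flipExp (fun x => (p (c x) : ℝ)) (fun ω => ((count c ω true i : ℝ) / N - p i) ^ 2) ≤ 1 / N := by
  have hN' : (0 : ℝ) < N := by exact_mod_cast hN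
  have h := flipExp_sq (fun x => (p (c x) : ℝ)) 0 (fun x => if c x = i then 1 / (N : ℝ) else 0)
  have hl : ∀ ω : Fin M → Bool, 0 + ∑ x, (if c x = i then 1 / (N : ℝ) else 0) *
      ((if ω x then 1 else 0) - (p (c x) : ℝ)) = (count c ω true i : ℝ) / N - p i := by
    intro ω
    simp only [mul_sub, Finset.sum_sub_distrib, zero_add]
    congr 1
    · rw [count, Finset.card_filter, Nat.cast_sum, Finset.sum_div]
      refine Finset.sum_congr rfl fun x _ => ?_
      by_cases h1 : c x = i <;> by_cases h2 : ω x = true <;> simp [h1, h2]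
    · have : ∀ x, (if c x = i then 1 / (N : ℝ) else 0) * (p (c x) : ℝ) =
          if c x = i then 1 / (N : ℝ) * p i else 0 := by
        intro x; split_ifs with h1
        · rw [h1]
        · rw [zero_mul]
      simp only [this, ← Finset.sum_filter, Finset.sum_const, hc]
      rw [nsmul_eq_mul]; field_simp
  simp only [hl] at h
  rw [h]
  have : ∀ x, (if c x = i then 1 / (N : ℝ) else 0) ^ 2 * ((p (c x) : ℝ) * (1 - p (c x))) ≤
      if c x = i then 1 / (N : ℝ) ^ 2 else 0 := by
    intro x
    split_ifs
    · rw [one_div, inv_pow, one_div]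
      have h1 : (p (c x) : ℝ) ≤ 1 := (p (c x)).2.2
      exact mul_le_of_le_one_right (by positivity) (by nlinarith [sq_nonneg (p (c x) : ℝ)])
    · simp
  calc (0 : ℝ) ^ 2 + ∑ x : Fin M, (if c x = i then 1 / (N : ℝ) else 0) ^ 2 *
        ((p (c x) : ℝ) * (1 - p (c x)))
      ≤ (0 : ℝ) ^ 2 + ∑ x : Fin M, if c x = i then 1 / (N : ℝ) ^ 2 else 0 := by
        gcongr with x; exact this x
    _ = 1 / (N : ℝ) := by
      rw [← Finset.sum_filter, Finset.sum_const, hc, nsmul_eq_mul]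
      field_simp
      ring

lemma card_flips (hc : ∀ i, (Finset.univ.filter fun x => c x = i).card = N) : M = n * N := by
  have h := Finset.card_eq_sum_card_fiberwise (s := (Finset.univ : Finset (Fin M)))
    (t := (Finset.univ : Finset (Fin n))) (f := c) (fun x _ => Finset.mem_univ _)
  simp only [hc] at h
  simpa using h

lemma exists_flips (n N : ℕ) : ∃ c : Fin (n * N) → Fin n,
    ∀ i, (Finset.univ.filter fun x => c x = i).card = N := by
  refine ⟨fun x => (finProdFinEquiv.symm x).1, fun i => ?_⟩
  have : (Finset.univ.filter fun x : Fin (n * N) => (finProdFinEquiv.symm x).1 = i) =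
      (Finset.univ : Finset (Fin N)).map
        ⟨fun j => finProdFinEquiv (i, j), fun j j' h => by simpa using h⟩ := by
    ext x
    simp only [Finset.mem_filter, Finset.mem_univ, true_and, Finset.mem_map]
    constructor
    · rintro rfl
      exact ⟨(finProdFinEquiv.symm x).2, finProdFinEquiv.apply_symm_apply x⟩
    · rintro ⟨j, rfl⟩
      exact congrArg Prod.fst (finProdFinEquiv.symm_apply_apply (i, j))
  rw [this, Finset.card_map, Finset.card_univ, Fintype.card_fin]

/-- If the rounded frequencies deviate from `p` by `η` or more, then so does, by `η / 2` or more,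
one of the frequencies. Hence Chebyshev's inequality applies. -/
lemma flipExp_ite_le {η : ℝ} (hη : 0 < η) (hL : 0 < L) (hR : 2 ≤ R) (hRη : 1 / (R : ℝ) ≤ η / 2)
    (hc : ∀ i, (Finset.univ.filter fun x => c x = i).card = R * L) (p : Cube n)
    {D : (Fin M → Bool) → Prop} [DecidablePred D] (hD : ∀ ω, D ω → η ≤ dist (roundedFreq L c ω) p) :
    flipExp (fun x => (p (c x) : ℝ)) (fun ω => if D ω then 1 else 0) ≤ 4 * n / η ^ 2 / L := by
  have hN : 0 < R * L := by positivity
  have hR' : (1 : ℝ) ≤ R := by exact_mod_cast (by omega : 1 ≤ R)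
  have hL' : (0 : ℝ) < L := by exact_mod_cast hL
  calc flipExp (fun x => (p (c x) : ℝ)) (fun ω => if D ω then 1 else 0)
      ≤ flipExp (fun x => (p (c x) : ℝ)) (fun ω => ∑ i, 4 / η ^ 2 *
          ((count c ω true i : ℝ) / (R * L : ℕ) - p i) ^ 2) := by
        refine flipExp_mono (fun x => (p (c x)).2) fun ω => ?_
        split_ifs with h
        · have hi : ∃ i, η ≤ dist (roundedFreq L c ω i) (p i) := by
            by_contra! hcon
            exact absurd ((dist_pi_lt_iff hη).2 hcon) (not_lt.2 (hD ω h))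
          obtain ⟨i, hi⟩ := hi
          rw [Subtype.dist_eq, Real.dist_eq] at hi
          have h2 : η / 2 ≤ |(count c ω true i : ℝ) / (R * L : ℕ) - p i| := by
            have := abs_sub_le (roundedFreq L c ω i : ℝ) (count c ω true i / (R * L : ℕ)) (p i)
            have := abs_roundedFreq_sub_le (ω := ω) hL hR hc i
            linarith
          have h3 : 1 ≤ 4 / η ^ 2 * ((count c ω true i : ℝ) / (R * L : ℕ) - p i) ^ 2 := by
            rw [← sq_abs ((count c ω true i : ℝ) / (R * L : ℕ) - p i)]
            calc (1 : ℝ) = 4 / η ^ 2 * (η / 2) ^ 2 := by field_simp; norm_num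
              _ ≤ _ := by gcongr
          exact h3.trans (Finset.single_le_sum (f := fun i => 4 / η ^ 2 *
            ((count c ω true i : ℝ) / (R * L : ℕ) - p i) ^ 2) (fun i _ => by positivity)
            (Finset.mem_univ i))
        · exact Finset.sum_nonneg fun i _ => by positivity
    _ = ∑ i, 4 / η ^ 2 * flipExp (fun x => (p (c x) : ℝ))
          (fun ω => ((count c ω true i : ℝ) / (R * L : ℕ) - p i) ^ 2) := flipExp_sum_mul _ _ _
    _ ≤ ∑ i : Fin n, 4 / η ^ 2 * (1 / L) := by
        gcongr with i
        refine (flipExp_count_div_sub_sq_le hN hc p i).trans ?_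
        rw [Nat.cast_mul]
        gcongr
        nlinarith
    _ = 4 * n / η ^ 2 / L := by
        rw [Finset.sum_const, Finset.card_univ, Fintype.card_fin, nsmul_eq_mul]
        ring

end rounding

/-! ### A factory that is good up to a constant factor -/

/-- Rounded empirical frequencies at which `h` is at least `1 / 2` have probability at most
`4 * h p`, which is plain if `h p` is at least `1 / 4`. Otherwise they are atypical, and only faces
matter on which `h` does not vanish. If the polynomial of one of them is not small at `p`, then
`h p` is bounded below and Chebyshev's inequality suffices. Otherwise every such outcome has a tiny
probability, which beats both the lower bound for `h p` and the number of outcomes. -/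
lemma PolynomiallyBounded.eventually_flipExp_le {h : Cube n → unitInterval}
    (hb : PolynomiallyBounded h) {η : ℝ} (hη : 0 < η)
    (hu : ∀ x y, dist x y < η → |(h x : ℝ) - h y| < 1 / 4) {R : ℕ} (hR : 2 ≤ R)
    (hRη : 1 / (R : ℝ) ≤ η / 2) :
    ∀ᶠ L in atTop, ∀ (M : ℕ) (c : Fin M → Fin n),
      (∀ i, (Finset.univ.filter fun x => c x = i).card = R * L) → ∀ p : Cube n,
        flipExp (fun x => (p (c x) : ℝ))
          (fun ω => if 1 / 2 ≤ (h (roundedFreq L c ω) : ℝ) then 1 else 0) ≤ 4 * h p := by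
  obtain ⟨m, κ, hκ, hb⟩ := hb
  -- There are `2 ^ (n * R * L)` outcomes, so that `2 ^ (n * R * L) * x₀ ^ L = (1 / 2) ^ L`.
  set x₀ : ℝ := (1 / 2) ^ (n * R + 1) with hx₀
  have hx₀pos : 0 < x₀ := by positivity
  have hlim1 : Tendsto (fun L : ℕ => 4 * n / η ^ 2 / (L : ℝ)) atTop (𝓝 0) :=
    tendsto_const_div_atTop_nhds_zero_nat _
  have hlim2 : Tendsto (fun L : ℕ => (1 / 2 : ℝ) ^ L) atTop (𝓝 0) :=
    tendsto_pow_atTop_nhds_zero_of_lt_one (by norm_num) (by norm_num)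
  have hpos : 0 < κ * x₀ ^ m := by positivity
  filter_upwards [hlim1.eventually (gt_mem_nhds hpos), hlim2.eventually (gt_mem_nhds hpos),
    eventually_gt_atTop 0, eventually_ge_atTop m] with L h1 h2 hL hmL M c hc p
  have hp0 : (0 : ℝ) ≤ h p := (h p).2.1
  by_cases hp : 1 / 4 ≤ (h p : ℝ)
  · calc _ ≤ flipExp (fun x => (p (c x) : ℝ)) (fun _ => 1) :=
          flipExp_mono (fun x => (p (c x)).2) fun ω => by split_ifs <;> norm_num
      _ = 1 := flipExp_one _
      _ ≤ 4 * h p := by linarith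
  push Not at hp
  by_cases hF : ∃ A S B, IsPartition A S B ∧ (¬ ∀ q ∈ openFace A S B, h q = 0) ∧
      x₀ ≤ facePoly A S B p
  · obtain ⟨A, S, B, hP, hne, hx⟩ := hF
    have hhp : κ * x₀ ^ m ≤ h p :=
      (by gcongr : κ * x₀ ^ m ≤ κ * facePoly A S B p ^ m).trans (hb A S B hP hne p)
    have hcheb := flipExp_ite_le (D := fun ω => 1 / 2 ≤ (h (roundedFreq L c ω) : ℝ)) hη hL hR hRη
      hc p fun ω hω => by
        by_contra! hcon
        have := (abs_lt.1 (hu _ _ hcon)).2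
        linarith
    exact hcheb.trans (by linarith)
  · push Not at hF
    have hω : ∀ ω : Fin M → Bool, flipWeight (fun x => (p (c x) : ℝ)) ω *
        (if 1 / 2 ≤ (h (roundedFreq L c ω) : ℝ) then 1 else 0) ≤ x₀ ^ (L - m) * (h p / κ) := by
      intro ω
      split_ifs with hh
      · obtain ⟨A, S, B, hP, hmem, hle⟩ := exists_face_roundedFreq (ω := ω) hL hR hc
        have hne : ∃ q ∈ openFace A S B, h q ≠ 0 := by
          refine ⟨_, hmem, fun h0 => ?_⟩
          rw [h0] at hh
          norm_num at hh
        have hF0 := facePoly_nonneg hP p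
        rw [mul_one]
        calc _ ≤ facePoly A S B p ^ L := hle p
          _ = facePoly A S B p ^ (L - m) * facePoly A S B p ^ m := by
            rw [← pow_add, Nat.sub_add_cancel hmL]
          _ ≤ x₀ ^ (L - m) * (h p / κ) := by
            refine mul_le_mul (pow_le_pow_left₀ hF0 (hF A S B hP hne).le _) ?_ (pow_nonneg hF0 _)
              (by positivity)
            rw [le_div_iff₀ hκ, mul_comm]
            exact hb A S B hP (by push Not; exact hne) p
      · rw [mul_zero]
        positivity
    have hM := card_flips hc
    have hxL : (2 : ℝ) ^ M * x₀ ^ L = (1 / 2) ^ L := by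
      rw [hM, hx₀, ← pow_mul, add_mul, one_mul, pow_add, ← mul_assoc, mul_assoc n, ← mul_pow]
      norm_num
    calc _ ≤ ∑ ω : Fin M → Bool, x₀ ^ (L - m) * (h p / κ) := Finset.sum_le_sum fun ω _ => hω ω
      _ = 2 ^ M * x₀ ^ L * (h p / (κ * x₀ ^ m)) := by
        rw [Finset.sum_const, Finset.card_univ, Fintype.card_fun, Fintype.card_bool,
          Fintype.card_fin, nsmul_eq_mul, Nat.cast_pow, Nat.cast_ofNat, pow_sub₀ _ hx₀pos.ne' hmL]
        field_simp
      _ ≤ κ * x₀ ^ m * (h p / (κ * x₀ ^ m)) := by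
        rw [hxL]
        gcongr
      _ = h p := by field_simp
      _ ≤ 4 * h p := by linarith

/-- The functions that turn out to be those that can be implemented. -/
def Admissible (f : Cube n → unitInterval) : Prop :=
  Continuous f ∧ PolynomiallyBounded f ∧ PolynomiallyBounded (fun p => unitInterval.symm (f p))

/-- The factory flips each coin equally often and outputs `1` if `f` is at least `1 / 2` at the
rounded frequencies. -/
lemma Admissible.exists_computes {f : Cube n → unitInterval} (hf : Admissible f) :
    ∃ (T : Factory n) (g : Cube n → ℝ), T.Computes g ∧
      ∀ p, g p ≤ 4 * f p ∧ 1 - g p ≤ 4 * (1 - f p) := by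
  obtain ⟨hcont, hb, hb'⟩ := hf
  obtain ⟨η, hη, hu⟩ := Metric.uniformContinuous_iff.1
    (CompactSpace.uniformContinuous_of_continuous hcont) (1 / 4) (by norm_num)
  have hu1 : ∀ x y, dist x y < η → |(f x : ℝ) - f y| < 1 / 4 := fun x y hxy => hu hxy
  have hu2 : ∀ x y, dist x y < η →
      |(unitInterval.symm (f x) : ℝ) - unitInterval.symm (f y)| < 1 / 4 := by
    intro x y hxy
    rw [unitInterval.coe_symm_eq, unitInterval.coe_symm_eq, sub_sub_sub_cancel_left, abs_sub_comm]
    exact hu1 x y hxy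
  obtain ⟨R, hR⟩ := exists_nat_ge (max 2 (2 / η))
  have hR2 : 2 ≤ R := by exact_mod_cast (le_max_left _ _).trans hR
  have hRη : 1 / (R : ℝ) ≤ η / 2 := by
    have h1 := (le_max_right _ _).trans hR
    rw [div_le_iff₀ hη] at h1
    rw [div_le_iff₀ (by positivity)]
    linarith
  obtain ⟨L, h1, h2⟩ := ((hb.eventually_flipExp_le hη hu1 hR2 hRη).and
    (hb'.eventually_flipExp_le hη hu2 hR2 hRη)).exists
  obtain ⟨c, hc⟩ := exists_flips n (R * L)
  classical
  obtain ⟨T, hT⟩ := exists_computes_flipExp c fun ω => 1 / 2 ≤ (f (roundedFreq L c ω) : ℝ)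
  refine ⟨T, _, hT, fun p => ⟨h1 _ c hc p, ?_⟩⟩
  rw [← flipExp_one_sub]
  have h3 := h2 _ c hc p
  rw [unitInterval.coe_symm_eq] at h3
  refine le_trans (flipExp_mono (fun x => (p (c x)).2) fun ω => ?_) h3
  rw [unitInterval.coe_symm_eq]
  split_ifs <;> linarith

/-- Polynomial boundedness passes to functions of comparable size. -/
lemma PolynomiallyBounded.of_le {f g : Cube n → unitInterval} (hf : PolynomiallyBounded f) {a : ℝ}
    (ha : 0 < a) (hfg : ∀ p, a * f p ≤ g p) (h0 : ∀ p, f p = 0 → g p = 0) :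
    PolynomiallyBounded g := by
  obtain ⟨m, κ, hκ, hb⟩ := hf
  refine ⟨m, a * κ, mul_pos ha hκ, fun A S B hP hne p => (le_trans ?_ (hfg p))⟩
  rw [mul_assoc]
  exact mul_le_mul_of_nonneg_left
    (hb A S B hP (fun h => hne fun q hq => h0 q (h q hq)) p) ha.le

/-- Subtracting `1 / 8` of an approximation leaves a function of the same kind. -/
lemma Admissible.exists_step {f : Cube n → unitInterval} (hf : Admissible f) :
    ∃ (T : Factory n) (g : Cube n → ℝ) (f' : Cube n → unitInterval), T.Computes g ∧
      Admissible f' ∧ ∀ p, (f p : ℝ) = 1 / 8 * g p + (1 - 1 / 8) * f' p := by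
  obtain ⟨T, g, hT, hg⟩ := hf.exists_computes
  have hg01 : ∀ p, 0 ≤ g p ∧ g p ≤ 1 := fun p => by
    have h1 := ge_of_tendsto' (hT p true) fun k => T.hitProb_nonneg p true k []
    have h2 := le_of_tendsto' (hT p true) fun k => T.hitProb_le_one p true k []
    simpa using And.intro h1 h2
  have hI : ∀ p, (8 * f p - g p) / 7 ∈ unitInterval := fun p =>
    ⟨by linarith [hg p, (f p).2.1], by linarith [hg p, (f p).2.2]⟩
  refine ⟨T, g, fun p => ⟨(8 * f p - g p) / 7, hI p⟩, hT, ⟨?_, ?_, ?_⟩, fun p => ?_⟩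
  · have h1 : Continuous fun p => (f p : ℝ) := continuous_subtype_val.comp hf.1
    exact (((continuous_const.mul h1).sub hT.continuous).div_const 7).subtype_mk hI
  · refine hf.2.1.of_le (a := 4 / 7) (by norm_num) (fun p => ?_) fun p hp => ?_
    · show 4 / 7 * (f p : ℝ) ≤ (8 * f p - g p) / 7
      linarith [hg p]
    · ext
      have := (hg p).1
      simp only [hp, Set.Icc.coe_zero] at this ⊢
      linarith [hg01 p]
  · refine hf.2.2.of_le (a := 4 / 7) (by norm_num) (fun p => ?_) fun p hp => ?_
    · rw [unitInterval.coe_symm_eq, unitInterval.coe_symm_eq]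
      show 4 / 7 * (1 - (f p : ℝ)) ≤ 1 - (8 * f p - g p) / 7
      linarith [hg p]
    · have hp1 : (f p : ℝ) = 1 := by
        have := congrArg Subtype.val hp
        rw [unitInterval.coe_symm_eq, Set.Icc.coe_zero] at this
        linarith
      ext
      have := (hg p).2
      rw [unitInterval.coe_symm_eq, Set.Icc.coe_zero]
      show 1 - (8 * (f p : ℝ) - g p) / 7 = 0
      linarith [hg01 p]
  · show (f p : ℝ) = 1 / 8 * g p + (1 - 1 / 8) * ((8 * f p - g p) / 7)
    ring

theorem Admissible.exists_implements {f : Cube n → unitInterval} (hf : Admissible f) :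
    ∃ T : Factory n, T.Implements f := by
  -- `F j` is the function that is left after `j` steps.
  choose T g next hT hnext heq using
    fun F : {f : Cube n → unitInterval // Admissible f} => F.2.exists_step
  let F : ℕ → {f : Cube n → unitInterval // Admissible f} := fun j =>
    (fun F => ⟨next F, hnext F⟩)^[j] ⟨f, hf⟩
  have hF : ∀ j, (F (j + 1)).1 = next (F j) := fun j => by
    simp only [F, Function.iterate_succ_apply']
  let c : unitInterval := ⟨1 / 8, by norm_num, by norm_num⟩
  have hc : 0 < c ∧ c < 1 := ⟨unitInterval.coe_pos.1 (by norm_num [c]),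
    unitInterval.coe_lt_one.1 (by norm_num [c])⟩
  refine ⟨Factory.mixture c hc (fun j => T (F j)) 0, (Factory.implements_iff_computes _ f).2 ?_⟩
  exact Factory.computes_mixture c hc (f := fun j p => ((F j).1 p : ℝ)) (fun j => hT (F j))
    (fun j p => ((F j).1 p).2) fun j p => by
      rw [hF]
      exact heq (F j) p

end BernoulliFactory

end

theorem mainTheorem1 (n : ℕ) (f : BernoulliFactory.Cube n → unitInterval) :
    (∃ T : BernoulliFactory.Factory n, T.Implements f) ↔
      Continuous f ∧ BernoulliFactory.PolynomiallyBounded f ∧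
        BernoulliFactory.PolynomiallyBounded (fun p => unitInterval.symm (f p)) := by
  constructor
  · rintro ⟨T, hT⟩
    have h := (BernoulliFactory.Factory.implements_iff_computes T f).1 hT
    exact ⟨continuous_induced_rng.2 h.continuous, h.polynomiallyBounded⟩
  · exact fun hf => BernoulliFactory.Admissible.exists_implements hf
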